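/- Let $V=\{1,\dots,n\}$, let $f_i,g_i:\mathbb{R}\to\mathbb{R}$ be convex, $A_0,A_i\in\mathbb{R}^{d\times d}$ symmetric, and $X_i\subset\mathbb{R}$ convex and compact ($i\in V$), $X=\prod_{i\in V} X_i$. Consider $$f^*=\min_{x\in X}\ f(x):=\sum_{i\in V} f_i(x_i)\quad\text{s.t.}\quad \sum_{i\in V} g_i(x_i)\le 0,\qquad A_0+\sum_{i\in V} A_ix_i\succeq 0,$$ and assume Slater's condition: some $\bar x\in X$ satisfies $\sum_i g_i(\bar x_i)<0$ and $A_0+\sum_i A_i\bar x_i\succ 0$. For $\mu\ge 0$ and $G\succeq 0$ (symmetric positive semidefinite $d\times d$) let $$\mathcal{L}(x,\mu,G)=f(x)+\mu\sum_i g_i(x_i)-\mathrm{tr}\Big[\Big(A_0+\sum_iA_ix_i\Big)G\Big],\qquad q(\mu,G)=\min_{x\in X}\mathcal{L}(x,\mu,G);$$ a dual optimal solution is a maximizer of $q$ over $\mu\ge 0$, $G\succeq 0$. Put $$L=\max_{i\in V,\,x_i\in X_i}|g_i(x_i)|,\qquad Q=\max_{i\in V,\,x_i\in X_i}\|-A_0/n-A_ix_i\|_{\mathrm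 F}.$$ Fix a stepsize $\alpha>0$ and any $\mu^0\ge 0$, $G^0\succeq 0$, and let, for $k\ge 0$ and $i\in V$, $$\tilde x_i^k\in\arg\min_{x_i\in X_i}\big\{f_i(x_i)+\mu^kg_i(x_i)-\mathrm{tr}[(A_0/n+A_ix_i)G^k]\big\},$$ $$\mu^{k+1}=\mathsf P_{\mathbb{R}_+}\Big[\mu^k+\alpha\sum_i g_i(\tilde x_i^k)\Big],\qquad G^{k+1}=\mathsf P_{\mathbb{S}^d_+}\Big[G^k-\alpha\Big(A_0+\sum_iA_i\tilde x_i^k\Big)\Big]$$ (projections in the absolute value and the Frobenius norm), and for $k\ge 1$ let $x^k=\frac1k\sum_{t=1}^k\tilde x^t$. Then: (a) The dual iterates are bounded: there are $\Lambda_0,\Gamma_0<\infty$ with $|\mu^k|\le\Lambda_0$ and $\|G^k\|_{\mathrm F}\le\Gamma_0$ for all $k\ge 1$. Moreover a dual optimal solution exists. (b) For all $\Lambda_0,\Gamma_0$ as in (a) and all $k\ge 1$, $$f(x^k)\le f^*+\frac{\Lambda_0^2+\Gamma_0^2}{2\alpha k}+\frac{\alpha n^2(L^2+Q^2)}{2}.$$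 (c) For all $\Lambda_0,\Gamma_0$ as in (a) that also satisfy $|\mu^*|\le\Lambda_0$ and $\|G^*\|_{\mathrm F}\le\Gamma_0$ for some dual optimal solution $(\mu^*,G^*)$, and all $k\ge 1$, $$f(x^k)\ge f^*-\frac{\Lambda_0^2+\Gamma_0^2}{\alpha k}.$$ -/

import Mathlib

open scoped Matrix

/-! Matrices carry the Frobenius norm throughout. -/

attribute [local instance] Matrix.frobeniusNormedAddCommGroup

/-- The data of the decomposable problem: minimize `∑ i, f i (x i)` over `x i ∈ X i`, subject to
`∑ i, g i (x i) ≤ 0` and `A₀ + ∑ i, x i • A i ⪰ 0`. -/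
structure DecompProblem (n d : ℕ) where
  /-- local cost functions -/
  f : Fin n → ℝ → ℝ
  /-- local terms of the scalar inequality constraint -/
  g : Fin n → ℝ → ℝ
  /-- constant matrix of the linear matrix inequality -/
  A₀ : Matrix (Fin d) (Fin d) ℝ
  /-- coefficient matrices of the linear matrix inequality -/
  A : Fin n → Matrix (Fin d) (Fin d) ℝ
  /-- local constraint sets -/
  X : Fin n → Set ℝ

/-- `p` is a metric projection of `z` onto `S` (the unique one when `S` is a nonempty closed convex
set and the norm is Euclidean). -/
def IsMetricProj {E : Type*} [NormedAddCommGroup E] (S : Set E) (z p : E) : Prop :=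
  p ∈ S ∧ ∀ y ∈ S, ‖z - p‖ ≤ ‖z - y‖

/-- The cone of (symmetric) positive semidefinite matrices. -/
def psdCone (d : ℕ) : Set (Matrix (Fin d) (Fin d) ℝ) := {G | G.PosSemidef}

namespace DecompProblem

variable {n d : ℕ} (P : DecompProblem n d)

/-- Convexity and compactness assumption. -/
structure ConvexCompact : Prop where
  convex_f : ∀ i, ConvexOn ℝ Set.univ (P.f i)
  convex_g : ∀ i, ConvexOn ℝ Set.univ (P.g i)
  convex_X : ∀ i, Convex ℝ (P.X i)
  compact_X : ∀ i, IsCompact (P.X i)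
  symm_A₀ : P.A₀.IsSymm
  symm_A : ∀ i, (P.A i).IsSymm

/-- The product set `X = ∏ i, X i`. -/
def box : Set (Fin n → ℝ) := {x | ∀ i, x i ∈ P.X i}

/-- The cost `f(x) = ∑ i, f i (x i)`. -/
def cost (x : Fin n → ℝ) : ℝ := ∑ i, P.f i (x i)

/-- The scalar constraint function `∑ i, g i (x i)`. -/
def scalarCon (x : Fin n → ℝ) : ℝ := ∑ i, P.g i (x i)

/-- The matrix constraint function `A₀ + ∑ i, x i • A i`. -/
def matrixCon (x : Fin n → ℝ) : Matrix (Fin d) (Fin d) ℝ := P.A₀ + ∑ i, x i • P.A i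

/-- The feasible set. -/
def feasible : Set (Fin n → ℝ) :=
  {x | x ∈ P.box ∧ P.scalarCon x ≤ 0 ∧ (P.matrixCon x).PosSemidef}

/-- Slater's condition: a point of `X` satisfies both constraints strictly. -/
def Slater : Prop := ∃ x ∈ P.box, P.scalarCon x < 0 ∧ (P.matrixCon x).PosDef

/-- The optimal value `f*`. -/
noncomputable def optVal : ℝ := sInf (P.cost '' P.feasible)

/-- The Lagrangian. -/
def lagrangian (x : Fin n → ℝ) (μ : ℝ) (G : Matrix (Fin d) (Fin d) ℝ) : ℝ :=
  P.cost x + μ * P.scalarCon x - (P.matrixCon x * G).trace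

/-- The dual function `q(μ, G) = min_{x ∈ X} L(x, μ, G)`. -/
noncomputable def dualFun (μ : ℝ) (G : Matrix (Fin d) (Fin d) ℝ) : ℝ :=
  sInf ((fun x => P.lagrangian x μ G) '' P.box)

/-- `(μ, G)` maximizes the dual function over `μ ≥ 0`, `G ⪰ 0`. -/
def IsDualOptimal (μ : ℝ) (G : Matrix (Fin d) (Fin d) ℝ) : Prop :=
  0 ≤ μ ∧ G.PosSemidef ∧
    ∀ (μ' : ℝ) (G' : Matrix (Fin d) (Fin d) ℝ), 0 ≤ μ' → G'.PosSemidef →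
      P.dualFun μ' G' ≤ P.dualFun μ G

/-- The local Lagrangian `L_i(x_i, μ, G) = f_i(x_i) + μ g_i(x_i) - tr[(A₀/n + A_i x_i) G]`. -/
noncomputable def localLagrangian (i : Fin n) (xi μ : ℝ) (G : Matrix (Fin d) (Fin d) ℝ) : ℝ :=
  P.f i xi + μ * P.g i xi - (((n : ℝ)⁻¹ • P.A₀ + xi • P.A i) * G).trace

/-- The constant `L = max_{i, x_i ∈ X_i} |g_i(x_i)|`. -/
noncomputable def boundL : ℝ := sSup {r | ∃ i, ∃ xi ∈ P.X i, r = |P.g i xi|}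

/-- The constant `Q = max_{i, x_i ∈ X_i} ‖-A₀/n - A_i x_i‖_F`. -/
noncomputable def boundQ : ℝ :=
  sSup {r | ∃ i, ∃ xi ∈ P.X i, r = ‖-((n : ℝ)⁻¹ • P.A₀) - xi • P.A i‖}

/-- `(μ^k, G^k, x̃^k)`, `k = 0, 1, …`, is generated by dual decomposition with stepsize `α`: any
nonnegative / positive semidefinite initial values, local minimizers `x̃_i^k` of the local
Lagrangians, projected subgradient dual updates. -/
structure IsRun (α : ℝ) (xt : ℕ → Fin n → ℝ) (μ : ℕ → ℝ)
    (G : ℕ → Matrix (Fin d) (Fin d) ℝ) : Prop where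
  init_μ : 0 ≤ μ 0
  init_G : (G 0).PosSemidef
  mem_X : ∀ k i, xt k i ∈ P.X i
  argmin : ∀ k i, ∀ y ∈ P.X i,
    P.localLagrangian i (xt k i) (μ k) (G k) ≤ P.localLagrangian i y (μ k) (G k)
  step_μ : ∀ k, IsMetricProj (Set.Ici (0 : ℝ)) (μ k + α * P.scalarCon (xt k)) (μ (k + 1))
  step_G : ∀ k, IsMetricProj (psdCone d) (G k - α • P.matrixCon (xt k)) (G (k + 1))

end DecompProblem

/-- The ergodic primal recovery `x^k = (1/k) ∑_{t=1}^k x̃^t` (used for `k ≥ 1`). -/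
noncomputable def ergodicAvg {n : ℕ} (xt : ℕ → Fin n → ℝ) (k : ℕ) : Fin n → ℝ :=
  fun i => (k : ℝ)⁻¹ * ∑ t ∈ Finset.Icc 1 k, xt t i

-- The iteration is projected supergradient ascent on the dual: the local minimizers together
-- minimize the Lagrangian, and the constraint values there are supergradients of $q$. Write
-- $\lambda^k=(\mu^k,G^k)$ and $C=n^2(L^2+Q^2)$. Projection onto a cone does not increase the norm,
-- so $\|\lambda^{k+1}\|^2\le\|\lambda^k\|^2+2\alpha(\mathcal L(\tilde x^k,\lambda^k)-f(\tilde
-- x^k))+\alpha^2C$ (`sq_norm_succ_le`).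
--
-- Boundedness: at a Slater point $\mathcal L\le f-\gamma(\mu+\|G\|)$, so a large $\lambda^k$ must
-- shrink (`exists_bound`). Upper bound: $\mathcal L(\tilde x^k,\lambda^k)\le f^*$; telescope the
-- inequality and apply convexity of $f$.
--
-- Lower bound: projecting onto a cone can only raise inner products with members of the cone
-- (`inner_le_inner`). Telescoped against a dual optimum, this bounds the averaged constraint
-- violation, while strong duality gives $f^*\le\mathcal L(x^k,\mu^*,G^*)$.
--
-- Strong duality comes from separating $(v,0,0)$, $v<f^*$, from the closed convex set `epiValues`;
-- letting $v\uparrow f^*$, Slater coercivity makes the multipliers compact, whence attainment.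

attribute [local instance] Matrix.frobeniusNormedSpace

/-- The inner product on real matrices that induces the Frobenius norm. -/
@[reducible]
noncomputable def Matrix.frobeniusInnerProductSpace {d : ℕ} :
    InnerProductSpace ℝ (Matrix (Fin d) (Fin d) ℝ) :=
  { Matrix.frobeniusNormedSpace with
    inner := fun A B => ∑ i, ∑ j, A i j * B i j
    norm_sq_eq_re_inner := fun A => by
      rw [Matrix.frobenius_norm_def, ← Real.sqrt_eq_rpow, Real.sq_sqrt (by positivity)]
      simp [sq]
    conj_inner_symm := fun A B => by simp [mul_comm]
    add_left := fun A B C => by simp [add_mul, Finset.sum_add_distrib]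
    smul_left := fun A B r => by simp [Finset.mul_sum, mul_assoc] }

attribute [local instance] Matrix.frobeniusInnerProductSpace

/-! ### Trace pairing and the positive semidefinite cone. -/

section Matrices

variable {d : ℕ}

theorem Matrix.frobenius_inner_def (A B : Matrix (Fin d) (Fin d) ℝ) :
    inner ℝ A B = ∑ i, ∑ j, A i j * B i j := rfl

theorem Matrix.trace_mul_eq_frobenius_inner {A B : Matrix (Fin d) (Fin d) ℝ} (hA : A.IsSymm) :
    (A * B).trace = inner ℝ A B := by
  rw [Matrix.frobenius_inner_def, Matrix.trace, Finset.sum_comm]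
  refine Finset.sum_congr rfl fun i _ => ?_
  rw [Matrix.diag_apply, Matrix.mul_apply]
  exact Finset.sum_congr rfl fun j _ => by rw [hA.apply]

theorem Matrix.PosSemidef.isSymm {A : Matrix (Fin d) (Fin d) ℝ} (hA : A.PosSemidef) :
    A.IsSymm := by
  have := hA.isHermitian.eq
  rwa [Matrix.conjTranspose_eq_transpose_of_trivial] at this

-- With $B=C^*C$, cyclicity turns the trace into that of the positive semidefinite matrix $CAC^*$.
open scoped MatrixOrder ComplexOrder in
theorem Matrix.PosSemidef.trace_mul_nonneg {A B : Matrix (Fin d) (Fin d) ℝ}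
    (hA : A.PosSemidef) (hB : B.PosSemidef) : 0 ≤ (A * B).trace := by
  obtain ⟨C, rfl⟩ := CStarAlgebra.nonneg_iff_eq_star_mul_self.mp hB.nonneg
  rw [← mul_assoc, Matrix.trace_mul_comm, ← mul_assoc]
  exact (hA.mul_mul_conjTranspose_same C).trace_nonneg

-- With $A=C^*C$ and $C$ invertible, $CBC^*$ is positive semidefinite of trace zero, hence zero;
-- then $C$ cancels.
open scoped MatrixOrder ComplexOrder in
theorem Matrix.PosDef.eq_zero_of_trace_mul_eq_zero {A B : Matrix (Fin d) (Fin d) ℝ}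
    (hA : A.PosDef) (hB : B.PosSemidef) (h : (A * B).trace = 0) : B = 0 := by
  obtain ⟨C, hC, rfl⟩ := CStarAlgebra.isStrictlyPositive_iff_eq_star_mul_self.mp
    hA.isStrictlyPositive
  rw [mul_assoc, Matrix.trace_mul_comm] at h
  have h0 := (hB.mul_mul_conjTranspose_same C).trace_eq_zero_iff.mp h
  lift C to (Matrix (Fin d) (Fin d) ℝ)ˣ using hC
  have h1 : star (C : Matrix (Fin d) (Fin d) ℝ) * star ((C⁻¹ : (Matrix (Fin d) (Fin d) ℝ)ˣ) :
      Matrix (Fin d) (Fin d) ℝ) = 1 := by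
    rw [← star_mul]; simp
  calc B = (↑C⁻¹ * ↑C) * B * (star (C : Matrix (Fin d) (Fin d) ℝ) *
      star ((C⁻¹ : (Matrix (Fin d) (Fin d) ℝ)ˣ) : Matrix (Fin d) (Fin d) ℝ)) := by
        rw [h1]; simp
    _ = ↑C⁻¹ * (↑C * B * star (C : Matrix (Fin d) (Fin d) ℝ)) *
      star ((C⁻¹ : (Matrix (Fin d) (Fin d) ℝ)ˣ) : Matrix (Fin d) (Fin d) ℝ) := by
        simp only [mul_assoc]
    _ = 0 := by rw [Matrix.star_eq_conjTranspose, h0]; simp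

theorem isClosed_psdCone : IsClosed (psdCone d) := by
  have : psdCone d = {G | Gᴴ = G} ∩ ⋂ x : Fin d → ℝ, {G | 0 ≤ star x ⬝ᵥ (G *ᵥ x)} := by
    ext G
    simp [psdCone, Matrix.posSemidef_iff_dotProduct_mulVec, Matrix.IsHermitian]
  rw [this]
  refine (isClosed_eq (by fun_prop) continuous_id).inter (isClosed_iInter fun x => ?_)
  exact isClosed_le continuous_const
    (continuous_const.dotProduct (continuous_id.matrix_mulVec continuous_const))

/-- By homogeneity $\gamma$ can be the minimum of the trace over the compact set of unit-norm
positive semidefinite matrices; it is positive by the preceding lemma. -/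
theorem Matrix.PosDef.exists_mul_norm_le_trace {M : Matrix (Fin d) (Fin d) ℝ} (hM : M.PosDef) :
    ∃ γ > 0, ∀ G : Matrix (Fin d) (Fin d) ℝ, G.PosSemidef → γ * ‖G‖ ≤ (M * G).trace := by
  have : ProperSpace (Matrix (Fin d) (Fin d) ℝ) := FiniteDimensional.proper ℝ _
  have hK : IsCompact (Metric.sphere (0 : Matrix (Fin d) (Fin d) ℝ) 1 ∩ psdCone d) :=
    (isCompact_sphere _ _).inter_right isClosed_psdCone
  have hc : Continuous fun G : Matrix (Fin d) (Fin d) ℝ => (M * G).trace :=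
    (continuous_const.matrix_mul continuous_id).matrix_trace
  -- The set is empty when `d = 0`; then every positive semidefinite matrix is zero.
  obtain h | hne := (Metric.sphere (0 : Matrix (Fin d) (Fin d) ℝ) 1 ∩ psdCone d).eq_empty_or_nonempty
  · refine ⟨1, one_pos, fun G hG => ?_⟩
    suffices G = 0 by simp [this]
    by_contra hG0
    have : ‖G‖⁻¹ • G ∈ Metric.sphere (0 : Matrix (Fin d) (Fin d) ℝ) 1 ∩ psdCone d :=
      ⟨by simp [norm_smul, hG0], hG.smul (by positivity)⟩
    simp [h] at this
  · obtain ⟨G₀, hG₀, hmin⟩ := hK.exists_isMinOn hne hc.continuousOn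
    refine ⟨(M * G₀).trace, ?_, fun G hG => ?_⟩
    · refine lt_of_le_of_ne (hM.posSemidef.trace_mul_nonneg hG₀.2) fun h => ?_
      have := hM.eq_zero_of_trace_mul_eq_zero hG₀.2 h.symm
      simp [this] at hG₀
    · by_cases hG0 : G = 0
      · simp [hG0]
      have hmem : ‖G‖⁻¹ • G ∈ Metric.sphere (0 : Matrix (Fin d) (Fin d) ℝ) 1 ∩ psdCone d :=
        ⟨by simp [norm_smul, hG0], hG.smul (by positivity)⟩
      have h1 : (M * G₀).trace ≤ (M * (‖G‖⁻¹ • G)).trace := hmin hmem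
      have hpos : 0 < ‖G‖ := norm_pos_iff.mpr hG0
      rw [Matrix.mul_smul, Matrix.trace_smul, smul_eq_mul] at h1
      calc (M * G₀).trace * ‖G‖ ≤ ‖G‖⁻¹ * (M * G).trace * ‖G‖ := by gcongr
        _ = (M * G).trace := by field_simp

/-- A linear functional on matrices that is nonnegative on the positive semidefinite cone agrees on
symmetric matrices with the trace pairing against a positive semidefinite matrix. -/
theorem exists_posSemidef_eq_trace_mul (c : Matrix (Fin d) (Fin d) ℝ →ₗ[ℝ] ℝ)
    (hc : ∀ S : Matrix (Fin d) (Fin d) ℝ, S.PosSemidef → 0 ≤ c S) :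
    ∃ G : Matrix (Fin d) (Fin d) ℝ, G.PosSemidef ∧ ∀ W, W.IsSymm → c W = (W * G).trace := by
  -- The representing matrix of `c` need not be symmetric; its symmetrization gives the same values
  -- on symmetric matrices.
  set G : Matrix (Fin d) (Fin d) ℝ := Matrix.of fun i j =>
    (c (Matrix.single i j 1) + c (Matrix.single j i 1)) / 2 with hG
  have hcW : ∀ W, c W = ∑ i, ∑ j, W i j * c (Matrix.single i j 1) := by
    intro W
    conv_lhs => rw [Matrix.matrix_eq_sum_single W]
    simp only [map_sum]
    refine Finset.sum_congr rfl fun i _ => Finset.sum_congr rfl fun j _ => ?_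
    rw [← smul_eq_mul, ← map_smul, Matrix.smul_single, smul_eq_mul, mul_one]
  have key : ∀ W, W.IsSymm → c W = (W * G).trace := by
    intro W hW
    rw [Matrix.trace_mul_eq_frobenius_inner hW, Matrix.frobenius_inner_def]
    have h2 : c W = ∑ i, ∑ j, W i j * c (Matrix.single j i 1) := by
      rw [hcW W, Finset.sum_comm]
      exact Finset.sum_congr rfl fun i _ => Finset.sum_congr rfl fun j _ => by rw [hW.apply]
    have h3 : ∑ i, ∑ j, W i j * G i j = (∑ i, ∑ j, W i j * c (Matrix.single i j 1) +
        ∑ i, ∑ j, W i j * c (Matrix.single j i 1)) / 2 := by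
      simp only [hG, Matrix.of_apply, ← Finset.sum_add_distrib, Finset.sum_div]
      exact Finset.sum_congr rfl fun i _ => Finset.sum_congr rfl fun j _ => by ring
    rw [h3, ← hcW, ← h2]; ring
  refine ⟨G, Matrix.PosSemidef.of_dotProduct_mulVec_nonneg ?_ fun x => ?_, key⟩
  · ext i j
    simp [hG, add_comm]
  -- Evaluating `c` at the rank-one matrix $xx^T$ gives the quadratic form of `G` at `x`.
  · have hps := Matrix.posSemidef_vecMulVec_self_star x
    have h := hc _ hps
    rw [key _ hps.isSymm, Matrix.vecMulVec_mul, Matrix.trace_vecMulVec] at h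
    rwa [Matrix.dotProduct_mulVec, dotProduct_comm]

end Matrices

/-! ### Metric projections onto convex sets and cones. -/

section Projection

variable {E : Type*} [NormedAddCommGroup E] [InnerProductSpace ℝ E] {S : Set E} {z p : E}

theorem IsMetricProj.inner_sub_le_zero (h : IsMetricProj S z p) (hS : Convex ℝ S) {y : E}
    (hy : y ∈ S) : inner ℝ (z - p) (y - p) ≤ 0 := by
  have hne : Nonempty S := ⟨⟨p, h.1⟩⟩
  refine (norm_eq_iInf_iff_real_inner_le_zero hS h.1).mp ?_ y hy
  exact le_antisymm (le_ciInf fun w => h.2 w w.2)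
    (ciInf_le ⟨0, by rintro _ ⟨w, rfl⟩; exact norm_nonneg _⟩ (⟨p, h.1⟩ : S))

/-- The variational inequality is tested at the competitor `p + y`. -/
theorem IsMetricProj.inner_le_inner (h : IsMetricProj S z p) (hS : Convex ℝ S)
    (hadd : ∀ x ∈ S, ∀ y ∈ S, x + y ∈ S) {y : E} (hy : y ∈ S) : inner ℝ z y ≤ inner ℝ p y := by
  have := h.inner_sub_le_zero hS (hadd p h.1 y hy)
  rw [add_sub_cancel_left, inner_sub_left] at this
  linarith

theorem IsMetricProj.norm_sq_le (h : IsMetricProj S z p) (hS : Convex ℝ S) (h0 : (0 : E) ∈ S) :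
    ‖p‖ ^ 2 ≤ ‖z‖ ^ 2 := by
  have h1 := h.inner_sub_le_zero hS h0
  have h2 : ‖z‖ ^ 2 = ‖z - p‖ ^ 2 + 2 * inner ℝ (z - p) p + ‖p‖ ^ 2 := by
    rw [← norm_add_sq_real, sub_add_cancel]
  rw [zero_sub, inner_neg_right] at h1
  nlinarith [sq_nonneg ‖z - p‖]

end Projection

theorem convex_psdCone (d : ℕ) : Convex ℝ (psdCone d) := fun _ hx _ hy _ _ ha hb _ =>
  Matrix.PosSemidef.add (Matrix.PosSemidef.smul hx ha) (Matrix.PosSemidef.smul hy hb)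

namespace DecompProblem

/-! ### Regularity of the problem data, weak duality, coercivity. -/

section Basic

variable {n d : ℕ} {P : DecompProblem n d}

theorem Slater.pos (hS : P.Slater) : 0 < n := by
  obtain ⟨x, -, hx, -⟩ := hS
  rcases Nat.eq_zero_or_pos n with rfl | h
  · simp [scalarCon] at hx
  · exact h

theorem ConvexCompact.continuous_f (hP : P.ConvexCompact) (i : Fin n) : Continuous (P.f i) :=
  continuousOn_univ.mp ((hP.convex_f i).continuousOn isOpen_univ)

theorem ConvexCompact.continuous_g (hP : P.ConvexCompact) (i : Fin n) : Continuous (P.g i) :=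
  continuousOn_univ.mp ((hP.convex_g i).continuousOn isOpen_univ)

theorem ConvexCompact.continuous_cost (hP : P.ConvexCompact) : Continuous P.cost :=
  continuous_finsetSum _ fun i _ => (hP.continuous_f i).comp (continuous_apply i)

theorem ConvexCompact.continuous_scalarCon (hP : P.ConvexCompact) : Continuous P.scalarCon :=
  continuous_finsetSum _ fun i _ => (hP.continuous_g i).comp (continuous_apply i)

theorem continuous_matrixCon : Continuous P.matrixCon :=
  continuous_const.add (continuous_finsetSum _ fun i _ =>
    (continuous_apply i).smul continuous_const)

theorem ConvexCompact.isCompact_box (hP : P.ConvexCompact) : IsCompact P.box := by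
  have : P.box = Set.univ.pi P.X := by ext; simp [box]
  rw [this]
  exact isCompact_univ_pi hP.compact_X

theorem ConvexCompact.convex_box (hP : P.ConvexCompact) : Convex ℝ P.box :=
  fun _ hx _ hy _ _ ha hb hab i => hP.convex_X i (hx i) (hy i) ha hb hab

theorem ConvexCompact.convexOn_cost (hP : P.ConvexCompact) : ConvexOn ℝ Set.univ P.cost := by
  refine ⟨convex_univ, fun x _ y _ a b ha hb hab => ?_⟩
  simp only [cost, Finset.smul_sum, ← Finset.sum_add_distrib]
  exact Finset.sum_le_sum fun i _ => (hP.convex_f i).2 trivial trivial ha hb hab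

theorem ConvexCompact.convexOn_scalarCon (hP : P.ConvexCompact) :
    ConvexOn ℝ Set.univ P.scalarCon := by
  refine ⟨convex_univ, fun x _ y _ a b ha hb hab => ?_⟩
  simp only [scalarCon, Finset.smul_sum, ← Finset.sum_add_distrib]
  exact Finset.sum_le_sum fun i _ => (hP.convex_g i).2 trivial trivial ha hb hab

theorem matrixCon_sum {ι : Type*} (s : Finset ι) (w : ι → ℝ) (hw : ∑ t ∈ s, w t = 1)
    (x : ι → Fin n → ℝ) :
    P.matrixCon (∑ t ∈ s, w t • x t) = ∑ t ∈ s, w t • P.matrixCon (x t) := by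
  simp only [matrixCon, smul_add, Finset.sum_add_distrib, ← Finset.sum_smul, hw, one_smul,
    Finset.smul_sum, smul_smul]
  rw [Finset.sum_comm]
  simp [← Finset.sum_smul]

theorem matrixCon_combo {a b : ℝ} (hab : a + b = 1) (x y : Fin n → ℝ) :
    P.matrixCon (a • x + b • y) = a • P.matrixCon x + b • P.matrixCon y := by
  simpa using matrixCon_sum (P := P) Finset.univ ![a, b] (by simpa using hab) ![x, y]

theorem ConvexCompact.isSymm_matrixCon (hP : P.ConvexCompact) (x : Fin n → ℝ) :
    (P.matrixCon x).IsSymm := by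
  simp only [Matrix.IsSymm, matrixCon, Matrix.transpose_add, Matrix.transpose_sum,
    Matrix.transpose_smul, (hP.symm_A _).eq, hP.symm_A₀.eq]

theorem ConvexCompact.bddBelow_lagrangian (hP : P.ConvexCompact) (μ : ℝ)
    (G : Matrix (Fin d) (Fin d) ℝ) : BddBelow ((fun x => P.lagrangian x μ G) '' P.box) :=
  hP.isCompact_box.bddBelow_image ((hP.continuous_cost.add
    (continuous_const.mul hP.continuous_scalarCon)).sub
      (continuous_matrixCon.matrix_mul continuous_const).matrix_trace).continuousOn

theorem ConvexCompact.bddBelow_cost_feasible (hP : P.ConvexCompact) :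
    BddBelow (P.cost '' P.feasible) :=
  (hP.isCompact_box.bddBelow_image hP.continuous_cost.continuousOn).mono
    (Set.image_mono fun _ hx => hx.1)

theorem ConvexCompact.optVal_le_cost (hP : P.ConvexCompact) {x : Fin n → ℝ}
    (hx : x ∈ P.feasible) : P.optVal ≤ P.cost x :=
  csInf_le hP.bddBelow_cost_feasible ⟨x, hx, rfl⟩

theorem Slater.feasible_nonempty (hS : P.Slater) : P.feasible.Nonempty := by
  obtain ⟨x, hx, hg, hM⟩ := hS
  exact ⟨x, hx, hg.le, hM.posSemidef⟩

theorem lagrangian_le_cost {x : Fin n → ℝ} (hx : x ∈ P.feasible) {μ : ℝ} (hμ : 0 ≤ μ)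
    {G : Matrix (Fin d) (Fin d) ℝ} (hG : G.PosSemidef) : P.lagrangian x μ G ≤ P.cost x := by
  have h1 := mul_nonpos_of_nonneg_of_nonpos hμ hx.2.1
  have h2 := hx.2.2.trace_mul_nonneg hG
  simp only [lagrangian]
  linarith

/-- Weak duality. -/
theorem ConvexCompact.dualFun_le_optVal (hP : P.ConvexCompact) (hS : P.Slater) {μ : ℝ}
    (hμ : 0 ≤ μ) {G : Matrix (Fin d) (Fin d) ℝ} (hG : G.PosSemidef) :
    P.dualFun μ G ≤ P.optVal := by
  refine le_csInf (hS.feasible_nonempty.image _) ?_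
  rintro _ ⟨x, hx, rfl⟩
  exact (csInf_le (hP.bddBelow_lagrangian μ G) ⟨x, hx.1, rfl⟩).trans (lagrangian_le_cost hx hμ hG)

/-- At a Slater point the Lagrangian is coercive in the multipliers. -/
theorem Slater.exists_lagrangian_le (hS : P.Slater) :
    ∃ x ∈ P.box, ∃ γ > 0, ∀ (μ : ℝ) (G : Matrix (Fin d) (Fin d) ℝ), 0 ≤ μ → G.PosSemidef →
      P.lagrangian x μ G ≤ P.cost x - γ * (μ + ‖G‖) := by
  obtain ⟨x, hx, hg, hM⟩ := hS
  obtain ⟨γ, hγ, h⟩ := hM.exists_mul_norm_le_trace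
  refine ⟨x, hx, min γ (-P.scalarCon x), lt_min hγ (by linarith), fun μ G hμ hG => ?_⟩
  have h1 : min γ (-P.scalarCon x) * ‖G‖ ≤ (P.matrixCon x * G).trace :=
    (mul_le_mul_of_nonneg_right (min_le_left _ _) (norm_nonneg _)).trans (h G hG)
  have h2 : min γ (-P.scalarCon x) * μ ≤ -P.scalarCon x * μ :=
    mul_le_mul_of_nonneg_right (min_le_right _ _) hμ
  simp only [lagrangian]
  linarith

end Basic

/-! ### Strong duality and dual attainment. -/

section StrongDuality

variable {n d : ℕ} {P : DecompProblem n d}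

variable (P) in
/-- The values of cost and constraints attained on the box, together with everything above. -/
def epiValues : Set (ℝ × ℝ × Matrix (Fin d) (Fin d) ℝ) :=
  {p | ∃ x ∈ P.box, P.cost x ≤ p.1 ∧ P.scalarCon x ≤ p.2.1 ∧
    (p.2.2 + P.matrixCon x).PosSemidef}

theorem ConvexCompact.convex_epiValues (hP : P.ConvexCompact) : Convex ℝ P.epiValues := by
  rintro p ⟨x, hx, hx1, hx2, hx3⟩ q ⟨y, hy, hy1, hy2, hy3⟩ a b ha hb hab
  refine ⟨a • x + b • y, hP.convex_box hx hy ha hb hab, ?_, ?_, ?_⟩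
  · refine (hP.convexOn_cost.2 trivial trivial ha hb hab).trans ?_
    simp only [smul_eq_mul, Prod.fst_add, Prod.smul_fst]
    gcongr
  · refine (hP.convexOn_scalarCon.2 trivial trivial ha hb hab).trans ?_
    simp only [smul_eq_mul, Prod.fst_add, Prod.smul_fst, Prod.snd_add, Prod.smul_snd]
    gcongr
  · have := convex_psdCone d hx3 hy3 ha hb hab
    rw [matrixCon_combo hab]
    convert (show Matrix.PosSemidef _ from this) using 1
    simp only [Prod.snd_add, Prod.smul_snd, smul_add]
    abel

/-- The set is the Minkowski sum of the compact image of the box and a closed cone. -/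
theorem ConvexCompact.isClosed_epiValues (hP : P.ConvexCompact) : IsClosed P.epiValues := by
  have hK : IsCompact ((fun x => (P.cost x, P.scalarCon x, -P.matrixCon x)) '' P.box) :=
    hP.isCompact_box.image (hP.continuous_cost.prodMk
      (hP.continuous_scalarCon.prodMk continuous_matrixCon.neg))
  have hT : IsClosed (Set.Ici (0 : ℝ) ×ˢ Set.Ici (0 : ℝ) ×ˢ psdCone d) :=
    isClosed_Ici.prod (isClosed_Ici.prod isClosed_psdCone)
  convert hT.add_left_of_isCompact hK using 1
  ext ⟨s, t, W⟩
  simp only [epiValues, Set.mem_ofPred_eq, Set.mem_add, Set.exists_mem_image, Set.mem_prod,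
    Set.mem_Ici]
  refine exists_congr fun x => and_congr_right fun _ => ⟨?_, ?_⟩
  · rintro ⟨h1, h2, h3⟩
    refine ⟨(s - P.cost x, t - P.scalarCon x, W + P.matrixCon x), ⟨?_, ?_, h3⟩, ?_⟩
    · simpa using h1
    · simpa using h2
    · simp
  · rintro ⟨⟨s', t', W'⟩, ⟨h1, h2, h3⟩, h⟩
    simp only [Prod.mk_add_mk, Prod.mk.injEq] at h
    obtain ⟨rfl, rfl, rfl⟩ := h
    exact ⟨by simpa using h1, by simpa using h2, by simpa [psdCone] using h3⟩

/-- An affine function bounded below on a ray has nonnegative slope; this gives the signs of the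
separating functional. -/
theorem nonneg_of_forall_lt_add_mul {u r a : ℝ} (h : ∀ τ : ℝ, 0 ≤ τ → u < r + τ * a) : 0 ≤ a := by
  by_contra! ha
  have h1 := h ((r - u) / (-a)) (div_nonneg (by simpa using (h 0 le_rfl).le) (by linarith))
  have h2 : (r - u) / (-a) * a = u - r := by field_simp [ha.ne]; ring
  linarith

/-- Every value below the optimum is a lower bound of the Lagrangian for suitable multipliers. -/
theorem ConvexCompact.exists_lt_lagrangian (hP : P.ConvexCompact) (hS : P.Slater) {v : ℝ}
    (hv : v < P.optVal) : ∃ (μ : ℝ) (G : Matrix (Fin d) (Fin d) ℝ), 0 ≤ μ ∧ G.PosSemidef ∧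
      ∀ x ∈ P.box, v ≤ P.lagrangian x μ G := by
  have hnot : (v, (0 : ℝ), (0 : Matrix (Fin d) (Fin d) ℝ)) ∉ P.epiValues := by
    rintro ⟨x, hx, h1, h2, h3⟩
    have h3' : (P.matrixCon x).PosSemidef := by simpa using h3
    exact absurd (hP.optVal_le_cost ⟨hx, h2, h3'⟩) (not_le.mpr (lt_of_le_of_lt h1 hv))
  have : LocallyConvexSpace ℝ (Matrix (Fin d) (Fin d) ℝ) :=
    inferInstanceAs (LocallyConvexSpace ℝ (Fin d → Fin d → ℝ))
  obtain ⟨φ, u, hu, hφ⟩ :=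
    geometric_hahn_banach_point_closed hP.convex_epiValues hP.isClosed_epiValues hnot
  set a := φ (1, 0, 0) with ha_def
  set b := φ (0, 1, 0) with hb_def
  set c : Matrix (Fin d) (Fin d) ℝ →ₗ[ℝ] ℝ :=
    φ.toLinearMap ∘ₗ LinearMap.inr ℝ ℝ _ ∘ₗ LinearMap.inr ℝ ℝ _ with hc_def
  have hφ' : ∀ s t W, φ (s, t, W) = s * a + t * b + c W := by
    intro s t W
    have : ((s, t, W) : ℝ × ℝ × Matrix (Fin d) (Fin d) ℝ) =
      s • (1, 0, 0) + t • (0, 1, 0) + (0, 0, W) := by simp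
    rw [this, map_add, map_add, map_smul, map_smul]
    simp [ha_def, hb_def, hc_def]
  have hval : ∀ x ∈ P.box, ∀ s t : ℝ, ∀ S : Matrix (Fin d) (Fin d) ℝ, 0 ≤ s → 0 ≤ t →
      S.PosSemidef → u < (P.cost x + s) * a + (P.scalarCon x + t) * b
        + (c S - c (P.matrixCon x)) := by
    intro x hx s t S hs ht hSp
    have := hφ (P.cost x + s, P.scalarCon x + t, S - P.matrixCon x)
      ⟨x, hx, by simpa using hs, by simpa using ht, by simpa using hSp⟩
    rwa [hφ', map_sub] at this
  obtain ⟨x₀, hx₀, hg₀, hM₀⟩ := hS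
  have ha : 0 ≤ a := by
    refine nonneg_of_forall_lt_add_mul (u := u) (r := P.cost x₀ * a + P.scalarCon x₀ * b
      - c (P.matrixCon x₀)) fun τ hτ => ?_
    have := hval x₀ hx₀ τ 0 0 hτ le_rfl .zero
    rw [map_zero] at this
    linarith
  have hb : 0 ≤ b := by
    refine nonneg_of_forall_lt_add_mul (u := u) (r := P.cost x₀ * a + P.scalarCon x₀ * b
      - c (P.matrixCon x₀)) fun τ hτ => ?_
    have := hval x₀ hx₀ 0 τ 0 le_rfl hτ .zero
    rw [map_zero] at this
    linarith
  have hc : ∀ S : Matrix (Fin d) (Fin d) ℝ, S.PosSemidef → 0 ≤ c S := by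
    intro S hSp
    refine nonneg_of_forall_lt_add_mul (u := u) (r := P.cost x₀ * a + P.scalarCon x₀ * b
      - c (P.matrixCon x₀)) fun τ hτ => ?_
    have := hval x₀ hx₀ 0 0 (τ • S) le_rfl le_rfl (hSp.smul hτ)
    rw [map_smul, smul_eq_mul] at this
    linarith
  obtain ⟨G, hG, hcG⟩ := exists_posSemidef_eq_trace_mul c hc
  have hsep : ∀ x ∈ P.box, v * a < P.cost x * a + P.scalarCon x * b
      - (P.matrixCon x * G).trace := by
    intro x hx
    have h1 := hval x hx 0 0 0 le_rfl le_rfl .zero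
    rw [hφ', map_zero] at hu
    rw [map_zero, hcG _ (hP.isSymm_matrixCon x)] at h1
    linarith
  -- If `a = 0`, the strict separation at the feasible point `x₀` would make a nonpositive number
  -- positive. So `a` can be normalized to 1.
  have ha' : 0 < a := by
    refine lt_of_le_of_ne ha fun h => ?_
    have h1 := hsep x₀ hx₀
    have h2 := mul_nonpos_of_nonpos_of_nonneg hg₀.le hb
    have h3 := hM₀.posSemidef.trace_mul_nonneg hG
    rw [← h] at h1
    linarith
  refine ⟨b / a, a⁻¹ • G, div_nonneg hb ha, hG.smul (inv_nonneg.mpr ha), fun x hx => ?_⟩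
  have h1 := hsep x hx
  rw [← sub_nonneg]
  have : P.lagrangian x (b / a) (a⁻¹ • G) - v = (P.cost x * a + P.scalarCon x * b
      - (P.matrixCon x * G).trace - v * a) / a := by
    simp only [lagrangian, Matrix.mul_smul, Matrix.trace_smul, smul_eq_mul]
    field_simp
  rw [this]
  exact div_nonneg (by linarith) ha

/-- Strong duality with dual attainment. -/
theorem ConvexCompact.exists_optVal_le_lagrangian (hP : P.ConvexCompact) (hS : P.Slater) :
    ∃ (μ : ℝ) (G : Matrix (Fin d) (Fin d) ℝ), 0 ≤ μ ∧ G.PosSemidef ∧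
      ∀ x ∈ P.box, P.optVal ≤ P.lagrangian x μ G := by
  -- Multipliers certifying the optimum up to $1/(m+1)$. These closed nonempty sets decrease and `D
  -- 0` is bounded by coercivity at a Slater point, so they share a point.
  set D : ℕ → Set (ℝ × Matrix (Fin d) (Fin d) ℝ) := fun m =>
    {p | 0 ≤ p.1} ∩ ({p | p.2 ∈ psdCone d} ∩
      ⋂ x ∈ P.box, {p | P.optVal - 1 / ((m : ℝ) + 1) ≤ P.lagrangian x p.1 p.2}) with hD
  have hclosed : ∀ m, IsClosed (D m) := by
    intro m
    refine (isClosed_le continuous_const continuous_fst).inter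
      ((isClosed_psdCone.preimage continuous_snd).inter
        (isClosed_biInter fun x _ => isClosed_le continuous_const ?_))
    exact (continuous_const.add (continuous_fst.mul continuous_const)).sub
      (continuous_const.matrix_mul continuous_snd).matrix_trace
  have hanti : ∀ m, D (m + 1) ⊆ D m := by
    rintro m p ⟨h1, h2, h3⟩
    refine ⟨h1, h2, ?_⟩
    simp only [Set.mem_iInter, Set.mem_ofPred_eq] at h3 ⊢
    intro x hx
    refine le_trans ?_ (h3 x hx)
    push_cast
    gcongr
    linarith
  have hne : ∀ m, (D m).Nonempty := by
    intro m
    have hpos : 0 < 1 / ((m : ℝ) + 1) := by positivity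
    obtain ⟨μ, G, hμ, hG, h⟩ := hP.exists_lt_lagrangian hS
      (show P.optVal - 1 / ((m : ℝ) + 1) < P.optVal by linarith)
    exact ⟨(μ, G), hμ, hG, by simpa using h⟩
  have hcomp : IsCompact (D 0) := by
    have : ProperSpace (Matrix (Fin d) (Fin d) ℝ) := FiniteDimensional.proper ℝ _
    obtain ⟨x₀, hx₀, γ, hγ, hco⟩ := hS.exists_lagrangian_le
    refine (isCompact_closedBall (0 : ℝ × Matrix (Fin d) (Fin d) ℝ)
      ((P.cost x₀ - P.optVal + 1) / γ)).of_isClosed_subset (hclosed 0) ?_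
    rintro ⟨μ, G⟩ ⟨h1, h2, h3⟩
    simp only [Set.mem_iInter, Set.mem_ofPred_eq] at h1 h3
    have h4 := (h3 x₀ hx₀).trans (hco μ G h1 h2)
    have h5 : μ + ‖G‖ ≤ (P.cost x₀ - P.optVal + 1) / γ := by
      rw [le_div_iff₀ hγ]
      norm_num at h4
      linarith
    rw [mem_closedBall_zero_iff, Prod.norm_def]
    refine max_le ?_ ?_
    · rw [Real.norm_of_nonneg h1]
      linarith [norm_nonneg G]
    · exact le_trans (by simpa using h1) h5
  obtain ⟨⟨μ, G⟩, hp⟩ := IsCompact.nonempty_iInter_of_sequence_nonempty_isCompact_isClosed D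
    hanti hne hcomp hclosed
  rw [Set.mem_iInter] at hp
  refine ⟨μ, G, (hp 0).1, (hp 0).2.1, fun x hx => ?_⟩
  have hlim : Filter.Tendsto (fun m : ℕ => P.optVal - 1 / ((m : ℝ) + 1)) Filter.atTop
      (nhds P.optVal) := by
    simpa using tendsto_const_nhds.sub (tendsto_one_div_add_atTop_nhds_zero_nat (𝕜 := ℝ))
  refine le_of_tendsto' hlim fun m => ?_
  have := (hp m).2.2
  simp only [Set.mem_iInter] at this
  exact this x hx

theorem ConvexCompact.exists_isDualOptimal (hP : P.ConvexCompact) (hS : P.Slater) :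
    ∃ (μ : ℝ) (G : Matrix (Fin d) (Fin d) ℝ), P.IsDualOptimal μ G ∧ P.optVal ≤ P.dualFun μ G := by
  obtain ⟨μ, G, hμ, hG, h⟩ := hP.exists_optVal_le_lagrangian hS
  have h' : P.optVal ≤ P.dualFun μ G := by
    obtain ⟨x₀, hx₀, -⟩ := hS
    refine le_csInf ⟨_, x₀, hx₀, rfl⟩ ?_
    rintro _ ⟨x, hx, rfl⟩
    exact h x hx
  exact ⟨μ, G, ⟨hμ, hG, fun μ' G' hμ' hG' => (hP.dualFun_le_optVal hS hμ' hG').trans h'⟩, h'⟩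

/-- Every dual optimum, not only the constructed one, has dual value at least $f^*$. -/
theorem IsDualOptimal.optVal_le_lagrangian (hP : P.ConvexCompact) (hS : P.Slater) {μ : ℝ}
    {G : Matrix (Fin d) (Fin d) ℝ} (h : P.IsDualOptimal μ G) {x : Fin n → ℝ} (hx : x ∈ P.box) :
    P.optVal ≤ P.lagrangian x μ G := by
  obtain ⟨μ₁, G₁, h₁, h₁'⟩ := hP.exists_isDualOptimal hS
  exact (h₁'.trans (h.2.2 μ₁ G₁ h₁.1 h₁.2.1)).trans
    (csInf_le (hP.bddBelow_lagrangian μ G) ⟨x, hx, rfl⟩)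

end StrongDuality

end DecompProblem

namespace DecompProblem

/-! ### Analysis of the dual iterates and of the ergodic averages. -/

section Run

variable {n d : ℕ} {P : DecompProblem n d} {α : ℝ} {xt : ℕ → Fin n → ℝ} {μ : ℕ → ℝ}
  {G : ℕ → Matrix (Fin d) (Fin d) ℝ}

theorem lagrangian_eq_sum_localLagrangian (hn : 0 < n) (x : Fin n → ℝ) (ν : ℝ)
    (H : Matrix (Fin d) (Fin d) ℝ) :
    P.lagrangian x ν H = ∑ i, P.localLagrangian i (x i) ν H := by
  have hn' : (n : ℝ) ≠ 0 := by positivity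
  simp only [lagrangian, localLagrangian, cost, scalarCon, matrixCon, Finset.sum_sub_distrib,
    Finset.sum_add_distrib, Finset.mul_sum, ← Matrix.trace_sum, ← Finset.sum_mul]
  simp [← Nat.cast_smul_eq_nsmul ℝ, smul_smul, hn']

theorem ConvexCompact.abs_g_le_boundL (hP : P.ConvexCompact) {i : Fin n} {y : ℝ}
    (hy : y ∈ P.X i) : |P.g i y| ≤ P.boundL := by
  refine le_csSup ?_ ⟨i, y, hy, rfl⟩
  have : {r | ∃ i, ∃ xi ∈ P.X i, r = |P.g i xi|} = ⋃ i, (fun y => |P.g i y|) '' P.X i := by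
    ext r; simp [eq_comm]
  rw [this]
  exact (isCompact_iUnion fun i =>
    (hP.compact_X i).image (hP.continuous_g i).abs).bddAbove

theorem ConvexCompact.norm_le_boundQ (hP : P.ConvexCompact) {i : Fin n} {y : ℝ}
    (hy : y ∈ P.X i) : ‖(n : ℝ)⁻¹ • P.A₀ + y • P.A i‖ ≤ P.boundQ := by
  rw [← norm_neg, neg_add']
  refine le_csSup ?_ ⟨i, y, hy, rfl⟩
  have : {r | ∃ i, ∃ xi ∈ P.X i, r = ‖-((n : ℝ)⁻¹ • P.A₀) - xi • P.A i‖} =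
      ⋃ i, (fun y => ‖-((n : ℝ)⁻¹ • P.A₀) - y • P.A i‖) '' P.X i := by
    ext r; simp [eq_comm]
  rw [this]
  have hc : ∀ i, Continuous fun y : ℝ => ‖-((n : ℝ)⁻¹ • P.A₀) - y • P.A i‖ := fun i =>
    (continuous_const.sub (continuous_id.smul continuous_const)).norm
  exact (isCompact_iUnion fun i => (hP.compact_X i).image (hc i)).bddAbove

theorem ConvexCompact.abs_scalarCon_le (hP : P.ConvexCompact) {x : Fin n → ℝ} (hx : x ∈ P.box) :
    |P.scalarCon x| ≤ n * P.boundL := by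
  refine (Finset.abs_sum_le_sum_abs _ _).trans
    ((Finset.sum_le_sum fun i _ => hP.abs_g_le_boundL (hx i)).trans ?_)
  simp

theorem ConvexCompact.norm_matrixCon_le (hP : P.ConvexCompact) (hn : 0 < n) {x : Fin n → ℝ}
    (hx : x ∈ P.box) : ‖P.matrixCon x‖ ≤ n * P.boundQ := by
  have hn' : (n : ℝ) ≠ 0 := by positivity
  have : P.matrixCon x = ∑ i, ((n : ℝ)⁻¹ • P.A₀ + x i • P.A i) := by
    simp [matrixCon, Finset.sum_add_distrib, ← Nat.cast_smul_eq_nsmul ℝ, smul_smul, hn']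
  rw [this]
  refine (norm_sum_le _ _).trans ((Finset.sum_le_sum fun i _ => hP.norm_le_boundQ (hx i)).trans ?_)
  simp

theorem ConvexCompact.constraint_sq_le (hP : P.ConvexCompact) (hn : 0 < n) {x : Fin n → ℝ}
    (hx : x ∈ P.box) :
    P.scalarCon x ^ 2 + ‖P.matrixCon x‖ ^ 2 ≤ (n : ℝ) ^ 2 * (P.boundL ^ 2 + P.boundQ ^ 2) := by
  have h1 := pow_le_pow_left₀ (abs_nonneg _) (hP.abs_scalarCon_le hx) 2
  have h2 := pow_le_pow_left₀ (norm_nonneg _) (hP.norm_matrixCon_le hn hx) 2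
  rw [sq_abs] at h1
  linarith

namespace IsRun

theorem mem_box (h : P.IsRun α xt μ G) (k : ℕ) : xt k ∈ P.box := fun i => h.mem_X k i

theorem lagrangian_le (h : P.IsRun α xt μ G) (hn : 0 < n) (k : ℕ) {y : Fin n → ℝ}
    (hy : y ∈ P.box) : P.lagrangian (xt k) (μ k) (G k) ≤ P.lagrangian y (μ k) (G k) := by
  rw [lagrangian_eq_sum_localLagrangian hn, lagrangian_eq_sum_localLagrangian hn]
  exact Finset.sum_le_sum fun i _ => h.argmin k i (y i) (hy i)

theorem μ_nonneg (h : P.IsRun α xt μ G) : ∀ k, 0 ≤ μ k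
  | 0 => h.init_μ
  | k + 1 => (h.step_μ k).1

theorem G_posSemidef (h : P.IsRun α xt μ G) : ∀ k, (G k).PosSemidef
  | 0 => h.init_G
  | k + 1 => (h.step_G k).1

/-- Zero lies in both cones, so projecting does not increase the norm. In the expanded square the
cross terms combine to $2\alpha(\mathcal L-f)$. -/
theorem sq_norm_succ_le (h : P.IsRun α xt μ G) (hP : P.ConvexCompact) (hn : 0 < n) (k : ℕ) :
    μ (k + 1) ^ 2 + ‖G (k + 1)‖ ^ 2 ≤ μ k ^ 2 + ‖G k‖ ^ 2
      + 2 * α * (P.lagrangian (xt k) (μ k) (G k) - P.cost (xt k))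
      + α ^ 2 * ((n : ℝ) ^ 2 * (P.boundL ^ 2 + P.boundQ ^ 2)) := by
  have h1 := (h.step_μ k).norm_sq_le (convex_Ici 0) Set.self_mem_Ici
  have h2 := (h.step_G k).norm_sq_le (convex_psdCone d) Matrix.PosSemidef.zero
  rw [norm_sub_sq_real, inner_smul_right, real_inner_comm, norm_smul, mul_pow,
    ← Matrix.trace_mul_eq_frobenius_inner (hP.isSymm_matrixCon _)] at h2
  simp only [Real.norm_eq_abs, sq_abs] at h1 h2
  have h3 := mul_le_mul_of_nonneg_left (hP.constraint_sq_le hn (h.mem_box k)) (sq_nonneg α)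
  simp only [lagrangian]
  linarith

theorem exists_bound (h : P.IsRun α xt μ G) (hα : 0 < α) (hP : P.ConvexCompact)
    (hS : P.Slater) : ∃ B : ℝ, ∀ k, |μ k| ≤ B ∧ ‖G k‖ ≤ B := by
  have hn := hS.pos
  obtain ⟨x₀, hx₀, γ, hγ, hco⟩ := hS.exists_lagrangian_le
  obtain ⟨c, hc⟩ := hP.isCompact_box.bddBelow_image hP.continuous_cost.continuousOn
  -- `K` bounds the increase of the squared norm in one step. Once $\mu^k+\|G^k\|\ge R$ the decrease
  -- $2\alpha\gamma(\mu^k+\|G^k\|)$ outweighs `K`; below `R` the next squared norm is at most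
  -- $R^2+K$. So `E` is preserved by induction.
  set K := 2 * α * (P.cost x₀ - c) + α ^ 2 * ((n : ℝ) ^ 2 * (P.boundL ^ 2 + P.boundQ ^ 2))
    with hK
  set R := K / (2 * α * γ) with hR
  set E := max (μ 0 ^ 2 + ‖G 0‖ ^ 2) (R ^ 2 + K) with hE
  have hstep : ∀ k, μ (k + 1) ^ 2 + ‖G (k + 1)‖ ^ 2 ≤
      μ k ^ 2 + ‖G k‖ ^ 2 + K - 2 * α * γ * (μ k + ‖G k‖) := by
    intro k
    have h1 := h.sq_norm_succ_le hP hn k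
    have h2 := (h.lagrangian_le hn k hx₀).trans (hco _ _ (h.μ_nonneg k) (h.G_posSemidef k))
    have h3 : c ≤ P.cost (xt k) := hc ⟨_, h.mem_box k, rfl⟩
    have h4 : 2 * α * (P.lagrangian (xt k) (μ k) (G k) - P.cost (xt k)) ≤
        2 * α * (P.cost x₀ - γ * (μ k + ‖G k‖) - c) := by
      gcongr
    linarith
  have hbound : ∀ k, μ k ^ 2 + ‖G k‖ ^ 2 ≤ E := by
    intro k
    induction k with
    | zero => exact le_max_left _ _
    | succ k ih =>
      have hμ := h.μ_nonneg k
      have hG := norm_nonneg (G k)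
      have h1 := hstep k
      rcases le_total R (μ k + ‖G k‖) with h2 | h2
      · rw [hR, div_le_iff₀ (by positivity)] at h2
        linarith
      · have h3 := pow_le_pow_left₀ (add_nonneg hμ hG) h2 2
        have h4 : 0 ≤ 2 * α * γ * (μ k + ‖G k‖) := by positivity
        have h5 := mul_nonneg hμ hG
        refine le_trans ?_ (le_max_right _ _)
        nlinarith
  refine ⟨√E, fun k => ⟨Real.abs_le_sqrt ?_, Real.le_sqrt_of_sq_le ?_⟩⟩
  · linarith [hbound k, sq_nonneg ‖G k‖]
  · linarith [hbound k, sq_nonneg (μ k)]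

theorem ergodicAvg_eq (k : ℕ) :
    ergodicAvg xt k = ∑ t ∈ Finset.Icc 1 k, (k : ℝ)⁻¹ • xt t := by
  ext i
  simp [ergodicAvg, Finset.mul_sum]

theorem sum_Icc_inv {k : ℕ} (hk : 1 ≤ k) : ∑ _t ∈ Finset.Icc 1 k, (k : ℝ)⁻¹ = 1 := by
  have : (k : ℝ) ≠ 0 := by positivity
  simp [this]

theorem map_ergodicAvg_le {F : (Fin n → ℝ) → ℝ} (hF : ConvexOn ℝ Set.univ F) {k : ℕ}
    (hk : 1 ≤ k) : F (ergodicAvg xt k) ≤ (k : ℝ)⁻¹ * ∑ t ∈ Finset.Icc 1 k, F (xt t) := by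
  rw [ergodicAvg_eq, Finset.mul_sum]
  exact hF.map_sum_le (fun _ _ => by positivity) (sum_Icc_inv hk) fun _ _ => trivial

theorem ergodicAvg_mem_box (h : P.IsRun α xt μ G) (hP : P.ConvexCompact) {k : ℕ} (hk : 1 ≤ k) :
    ergodicAvg xt k ∈ P.box := by
  rw [ergodicAvg_eq]
  exact hP.convex_box.sum_mem (fun _ _ => by positivity) (sum_Icc_inv hk) fun t _ => h.mem_box t

/-- The left side is the dual value at the iterate, so this is weak duality. -/
theorem lagrangian_le_optVal (h : P.IsRun α xt μ G) (hS : P.Slater) (k : ℕ) :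
    P.lagrangian (xt k) (μ k) (G k) ≤ P.optVal := by
  refine le_csInf (hS.feasible_nonempty.image _) ?_
  rintro _ ⟨x, hx, rfl⟩
  exact (h.lagrangian_le hS.pos k hx.1).trans
    (lagrangian_le_cost hx (h.μ_nonneg k) (h.G_posSemidef k))

/-- `sq_norm_succ_le` divided by $2\alpha$ telescopes. The average starts at $t=1$, hence the
boundary term at index 1 instead of 0. -/
theorem sum_cost_le (h : P.IsRun α xt μ G) (hα : 0 < α) (hP : P.ConvexCompact) (hS : P.Slater)
    (k : ℕ) : ∑ t ∈ Finset.Icc 1 k, P.cost (xt t) ≤ k * P.optVal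
      + (μ 1 ^ 2 + ‖G 1‖ ^ 2 - (μ (k + 1) ^ 2 + ‖G (k + 1)‖ ^ 2)) / (2 * α)
      + k * (α * ((n : ℝ) ^ 2 * (P.boundL ^ 2 + P.boundQ ^ 2)) / 2) := by
  induction k with
  | zero => simp
  | succ k ih =>
    rw [Finset.sum_Icc_succ_top (by omega)]
    have h1 := h.sq_norm_succ_le hP hS.pos (k + 1)
    have h2 := h.lagrangian_le_optVal hS (k + 1)
    have h3 : P.cost (xt (k + 1)) ≤ P.lagrangian (xt (k + 1)) (μ (k + 1)) (G (k + 1)) +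
        (μ (k + 1) ^ 2 + ‖G (k + 1)‖ ^ 2 - (μ (k + 1 + 1) ^ 2 + ‖G (k + 1 + 1)‖ ^ 2)) / (2 * α)
        + α * ((n : ℝ) ^ 2 * (P.boundL ^ 2 + P.boundQ ^ 2)) / 2 := by
      rw [← sub_nonneg] at h1 ⊢
      refine (div_nonneg h1 (by positivity : 0 ≤ 2 * α)).trans_eq ?_
      field_simp
      ring
    push_cast
    rw [sub_div] at ih h3 ⊢
    linarith

theorem cost_ergodicAvg_le (h : P.IsRun α xt μ G) (hα : 0 < α) (hP : P.ConvexCompact)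
    (hS : P.Slater) {Λ Γ : ℝ} (hΛ : |μ 1| ≤ Λ) (hΓ : ‖G 1‖ ≤ Γ) {k : ℕ} (hk : 1 ≤ k) :
    P.cost (ergodicAvg xt k) ≤ P.optVal + (Λ ^ 2 + Γ ^ 2) / (2 * α * k)
      + α * (n : ℝ) ^ 2 * (P.boundL ^ 2 + P.boundQ ^ 2) / 2 := by
  have hk' : (0 : ℝ) < k := by exact_mod_cast hk
  have h1 := h.sum_cost_le hα hP hS k
  have h2 : (μ 1 ^ 2 + ‖G 1‖ ^ 2 - (μ (k + 1) ^ 2 + ‖G (k + 1)‖ ^ 2)) / (2 * α) ≤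
      (Λ ^ 2 + Γ ^ 2) / (2 * α) := by
    have h3 := pow_le_pow_left₀ (abs_nonneg _) hΛ 2
    have h4 := pow_le_pow_left₀ (norm_nonneg _) hΓ 2
    rw [sq_abs] at h3
    gcongr
    linarith [sq_nonneg (μ (k + 1)), sq_nonneg ‖G (k + 1)‖]
  calc P.cost (ergodicAvg xt k) ≤ (k : ℝ)⁻¹ * ∑ t ∈ Finset.Icc 1 k, P.cost (xt t) :=
        map_ergodicAvg_le hP.convexOn_cost hk
    _ ≤ (k : ℝ)⁻¹ * (k * P.optVal + (Λ ^ 2 + Γ ^ 2) / (2 * α)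
      + k * (α * ((n : ℝ) ^ 2 * (P.boundL ^ 2 + P.boundQ ^ 2)) / 2)) := by
        gcongr
        linarith
    _ = _ := by field_simp

/-- Pairing each update with a fixed cone element `ν` and telescoping; `neg_inner_sum_matrixCon_le`
is the matrix counterpart. -/
theorem mul_sum_scalarCon_le (h : P.IsRun α xt μ G) {ν : ℝ} (hν : 0 ≤ ν) (k : ℕ) :
    α * (ν * ∑ t ∈ Finset.Icc 1 k, P.scalarCon (xt t)) ≤ ν * μ (k + 1) - ν * μ 1 := by
  induction k with
  | zero => simp
  | succ k ih =>
    rw [Finset.sum_Icc_succ_top (by omega)]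
    have h1 := (h.step_μ (k + 1)).inner_le_inner (convex_Ici 0)
      (fun x hx y hy => add_nonneg (Set.mem_Ici.mp hx) hy) (Set.mem_Ici.mpr hν)
    simp only [RCLike.inner_apply, conj_trivial] at h1
    linarith

theorem neg_inner_sum_matrixCon_le (h : P.IsRun α xt μ G) {H : Matrix (Fin d) (Fin d) ℝ}
    (hH : H.PosSemidef) (k : ℕ) :
    -(α * inner ℝ (∑ t ∈ Finset.Icc 1 k, P.matrixCon (xt t)) H) ≤
      inner ℝ (G (k + 1)) H - inner ℝ (G 1) H := by
  induction k with
  | zero => simp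
  | succ k ih =>
    rw [Finset.sum_Icc_succ_top (by omega), inner_add_left]
    have h1 := (h.step_G (k + 1)).inner_le_inner (convex_psdCone d)
      (fun x hx y hy => Matrix.PosSemidef.add hx hy) (y := H) hH
    rw [inner_sub_left, real_inner_smul_left] at h1
    linarith

theorem le_cost_ergodicAvg (h : P.IsRun α xt μ G) (hα : 0 < α) (hP : P.ConvexCompact)
    (hS : P.Slater) {Λ Γ : ℝ} {k : ℕ} (hk : 1 ≤ k) (hΛ : |μ (k + 1)| ≤ Λ)
    (hΓ : ‖G (k + 1)‖ ≤ Γ) {ν : ℝ} {H : Matrix (Fin d) (Fin d) ℝ} (hopt : P.IsDualOptimal ν H)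
    (hν : |ν| ≤ Λ) (hH : ‖H‖ ≤ Γ) :
    P.optVal - (Λ ^ 2 + Γ ^ 2) / (α * k) ≤ P.cost (ergodicAvg xt k) := by
  have hk' : (0 : ℝ) < k := by exact_mod_cast hk
  have hν0 := hopt.1
  have hH0 := hopt.2.1
  have hdual := hopt.optVal_le_lagrangian hP hS (h.ergodicAvg_mem_box hP hk)
  have hg : ν * P.scalarCon (ergodicAvg xt k) ≤
      (k : ℝ)⁻¹ * (ν * ∑ t ∈ Finset.Icc 1 k, P.scalarCon (xt t)) := by
    rw [mul_left_comm]
    exact mul_le_mul_of_nonneg_left (map_ergodicAvg_le hP.convexOn_scalarCon hk) hν0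
  have hM : (P.matrixCon (ergodicAvg xt k) * H).trace =
      (k : ℝ)⁻¹ * inner ℝ (∑ t ∈ Finset.Icc 1 k, P.matrixCon (xt t)) H := by
    rw [Matrix.trace_mul_eq_frobenius_inner (hP.isSymm_matrixCon _), ergodicAvg_eq,
      matrixCon_sum _ _ (sum_Icc_inv hk), ← Finset.smul_sum, real_inner_smul_left]
  have h1 : ν * μ (k + 1) ≤ Λ ^ 2 := by
    rw [sq, ← abs_of_nonneg hν0, ← abs_of_nonneg (h.μ_nonneg (k + 1))]
    exact mul_le_mul hν hΛ (abs_nonneg _) ((abs_nonneg _).trans hν)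
  have h2 : inner ℝ (G (k + 1)) H ≤ Γ ^ 2 := by
    rw [sq]
    exact (real_inner_le_norm _ _).trans
      (mul_le_mul hΓ hH (norm_nonneg _) ((norm_nonneg _).trans hH))
  -- The index-1 boundary terms are nonnegative and can be dropped, so only the iterate `k + 1`
  -- enters the bound.
  have h3 : 0 ≤ inner ℝ (G 1) H := by
    rw [← Matrix.trace_mul_eq_frobenius_inner (h.G_posSemidef 1).isSymm]
    exact (h.G_posSemidef 1).trace_mul_nonneg hH0
  have h4 := mul_nonneg hν0 (h.μ_nonneg 1)
  have h5 := h.mul_sum_scalarCon_le hν0 k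
  have h6 := h.neg_inner_sum_matrixCon_le hH0 k
  have h7 : (k : ℝ)⁻¹ * (ν * ∑ t ∈ Finset.Icc 1 k, P.scalarCon (xt t)) -
      (k : ℝ)⁻¹ * inner ℝ (∑ t ∈ Finset.Icc 1 k, P.matrixCon (xt t)) H ≤
      (Λ ^ 2 + Γ ^ 2) / (α * k) := by
    rw [le_div_iff₀ (by positivity)]
    calc _ = α * (ν * ∑ t ∈ Finset.Icc 1 k, P.scalarCon (xt t)) -
        α * inner ℝ (∑ t ∈ Finset.Icc 1 k, P.matrixCon (xt t)) H := by field_simp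
      _ ≤ _ := by linarith
  simp only [lagrangian] at hdual
  rw [hM] at hdual
  linarith

end IsRun

end Run

end DecompProblem

theorem theorem0 {n d : ℕ} (P : DecompProblem n d) (hP : P.ConvexCompact) (hS : P.Slater)
    (α : ℝ) (hα : 0 < α) (xt : ℕ → Fin n → ℝ) (μ : ℕ → ℝ)
    (G : ℕ → Matrix (Fin d) (Fin d) ℝ) (hrun : P.IsRun α xt μ G) :
    -- (a) the dual iterates are bounded, and the dual problem has an optimal solution
    ((∃ Λ₀ Γ₀ : ℝ, ∀ k : ℕ, 1 ≤ k → |μ k| ≤ Λ₀ ∧ ‖G k‖ ≤ Γ₀) ∧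
      ∃ (μs : ℝ) (Gs : Matrix (Fin d) (Fin d) ℝ), P.IsDualOptimal μs Gs) ∧
    ∀ Λ₀ Γ₀ : ℝ, (∀ k : ℕ, 1 ≤ k → |μ k| ≤ Λ₀ ∧ ‖G k‖ ≤ Γ₀) →
      -- (b) upper bound, for every bound `Λ₀, Γ₀` on the dual iterates
      (∀ k : ℕ, 1 ≤ k →
        P.cost (ergodicAvg xt k) ≤ P.optVal + (Λ₀ ^ 2 + Γ₀ ^ 2) / (2 * α * k)
          + α * (n : ℝ) ^ 2 * (P.boundL ^ 2 + P.boundQ ^ 2) / 2) ∧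
      -- (c) lower bound, when `Λ₀, Γ₀` also bound some dual optimal solution
      ((∃ (μs : ℝ) (Gs : Matrix (Fin d) (Fin d) ℝ),
          P.IsDualOptimal μs Gs ∧ |μs| ≤ Λ₀ ∧ ‖Gs‖ ≤ Γ₀) →
        ∀ k : ℕ, 1 ≤ k →
          P.optVal - (Λ₀ ^ 2 + Γ₀ ^ 2) / (α * k) ≤ P.cost (ergodicAvg xt k)) := by
  refine ⟨⟨?_, ?_⟩, fun Λ₀ Γ₀ hb => ⟨fun k hk => ?_, ?_⟩⟩
  · obtain ⟨B, hB⟩ := hrun.exists_bound hα hP hS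
    exact ⟨B, B, fun k _ => hB k⟩
  · obtain ⟨μs, Gs, h, -⟩ := hP.exists_isDualOptimal hS
    exact ⟨μs, Gs, h⟩
  · exact hrun.cost_ergodicAvg_le hα hP hS (hb 1 le_rfl).1 (hb 1 le_rfl).2 hk
  · rintro ⟨μs, Gs, hopt, hμs, hGs⟩ k hk
    exact hrun.le_cost_ergodicAvg hα hP hS hk (hb (k + 1) (by omega)).1
      (hb (k + 1) (by omega)).2 hopt hμs hGs
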